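/- \textbf{Theorem.} There is a universal constant $c>0$ such that the following holds. Let $d,m\ge 1$ and $T\ge 0$ be integers and let $a,b$ be real numbers with $a\ge 5$ and $a<b\le\log d$ (natural logarithm). For a unit vector $|\psi\rangle\in\mathbb C^d\otimes\mathbb C^d$ let $\rho$ be its reduced density matrix on the first register and $H_2(|\psi\rangle)=-\log\operatorname{Tr}(\rho^2)$ its R\'enyi $2$-entropy. In the Entanglement Entropy problem one is given query access to $U=I-2|\psi\rangle\langle\psi|$, and must accept if $H_2(|\psi\rangle)\ge b$ (yes instances) and reject if $H_2(|\psi\rangle)\le a$ (no instances), promised that one of the two holds. A $T$-query quantum algorithm with an $m$-qubit witness acts on a control qubit, a query register $\mathbb C^d\otimes\mathbb C^d$, a finite-dimensional ancilla register and an $m$-qubit witness register. The witness register is initialized with the witness state and the rest with a fixed basis state; the algorithm applies fixed unitaries $A_0,\dots,A_T$, independent of $U$, interleaved with $T$ controlled applications of $U$ or $U^*$ (which of the two is fixed for each query), then measures in the standard basis and accepts if the outcome lies in a fixed set. It solves the Entanglement Entropy problem if for every yes instance there is a (pure) witness state on which it accepts with probability at least $2/3$, and for every no instance it accepts with probability at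 most $1/3$ on every witness state. If a $T$-query algorithm with an $m$-qubit witness solves the Entanglement Entropy problem with parameters $d,a,b$, then $$mT\;\ge\; c\,\exp(a/4).$$ -/

import Mathlib

/-- A promise problem on unitaries acting on `ℂ^ι`: disjoint sets of *yes* and *no* instances. -/
structure UnitaryProperty (ι : Type) [Fintype ι] [DecidableEq ι] where
  yes : Set (Matrix.unitaryGroup ι ℂ)
  no : Set (Matrix.unitaryGroup ι ℂ)
  disj : Disjoint yes no

/-- Basis labels of the total register of a query algorithm: control qubit, query register `ι`,
ancilla register of dimension `r`, and a witness register of `m` qubits. -/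
abbrev RegisterIndex (ι : Type) (r m : ℕ) : Type :=
  Bool × ι × Fin r × (Fin m → Bool)

/-- A quantum query algorithm with an `m`-qubit witness, making `numQueries` queries to a unitary
on `ℂ^ι` or its inverse: fixed unitaries `gate 0, …, gate numQueries` on the total register,
interleaved with controlled applications of `U` or `U*`, followed by a measurement in the standard
basis. Query number `t` (for `t < numQueries`) is to `U*` if `useInverse t = true` and to `U`
otherwise; values of `gate` and `useInverse` beyond these ranges are never used. -/
structure QueryAlgorithm (ι : Type) [Fintype ι] [DecidableEq ι] (m : ℕ) where
  /-- number of queries -/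
  numQueries : ℕ
  /-- dimension of the ancilla register -/
  ancDim : ℕ
  /-- initial basis state of control qubit, query register and ancilla register -/
  start : Bool × ι × Fin ancDim
  /-- the fixed unitaries, independent of the oracle -/
  gate : ℕ → Matrix.unitaryGroup (RegisterIndex ι ancDim m) ℂ
  /-- which queries are to the inverse of the oracle -/
  useInverse : ℕ → Bool
  /-- the measurement outcomes on which the algorithm accepts -/
  accept : Finset (RegisterIndex ι ancDim m)

/-- Controlled application of the matrix `M` to the query register: nothing happens if the control
qubit is `0` (`false`), and `M` is applied if it is `1` (`true`). -/
noncomputable def controlledApply {ι K : Type} [Fintype ι] (M : Matrix ι ι ℂ)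
    (v : Bool × ι × K → ℂ) : Bool × ι × K → ℂ
  | (false, i, k) => v (false, i, k)
  | (true, i, k) => ∑ j, M i j * v (true, j, k)

namespace QueryAlgorithm

variable {ι : Type} [Fintype ι] [DecidableEq ι] {m : ℕ}

/-- The initial state: the witness state in the witness register, and the fixed basis state
`start` in the other registers. -/
noncomputable def initialState (A : QueryAlgorithm ι m) (w : EuclideanSpace ℂ (Fin m → Bool)) :
    RegisterIndex ι A.ancDim m → ℂ :=
  fun s => if (s.1, s.2.1, s.2.2.1) = A.start then w s.2.2.2 else 0

/-- The state after `t` queries and the application of `gate t`. -/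
noncomputable def stateAfter (A : QueryAlgorithm ι m) (U : Matrix.unitaryGroup ι ℂ)
    (w : EuclideanSpace ℂ (Fin m → Bool)) : ℕ → (RegisterIndex ι A.ancDim m → ℂ)
  | 0 => Matrix.mulVec (A.gate 0).1 (A.initialState w)
  | t + 1 => Matrix.mulVec (A.gate (t + 1)).1
      (controlledApply (if A.useInverse t then (star U).1 else U.1) (A.stateAfter U w t))

/-- The probability that the algorithm accepts with oracle `U` and witness state `w`. -/
noncomputable def acceptProb (A : QueryAlgorithm ι m) (U : Matrix.unitaryGroup ι ℂ)
    (w : EuclideanSpace ℂ (Fin m → Bool)) : ℝ :=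
  ∑ s ∈ A.accept, ‖A.stateAfter U w A.numQueries s‖ ^ 2

/-- The algorithm is a QMA tester for the property `P`: on yes instances some witness state is
accepted with probability at least `2/3`, and on no instances every witness state is accepted with
probability at most `1/3`. -/
def IsQMATester (A : QueryAlgorithm ι m) (P : UnitaryProperty ι) : Prop :=
  (∀ U ∈ P.yes, ∃ w : EuclideanSpace ℂ (Fin m → Bool), ‖w‖ = 1 ∧ 2 / 3 ≤ A.acceptProb U w) ∧
  (∀ U ∈ P.no, ∀ w : EuclideanSpace ℂ (Fin m → Bool), ‖w‖ = 1 → A.acceptProb U w ≤ 1 / 3)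

end QueryAlgorithm

/-- The matrix `|ψ⟩⟨ψ|`. -/
noncomputable def pureDensity {ι : Type} (ψ : EuclideanSpace ℂ ι) : Matrix ι ι ℂ :=
  Matrix.of fun i j => ψ i * star (ψ j)

/-- The reduced density matrix on the first register of `ψ ∈ ℂ^d ⊗ ℂ^d`: the partial trace of
`|ψ⟩⟨ψ|` over the second register. -/
noncomputable def reducedDensity {d : ℕ} (ψ : EuclideanSpace ℂ (Fin d × Fin d)) :
    Matrix (Fin d) (Fin d) ℂ :=
  Matrix.of fun i i' => ∑ j, pureDensity ψ (i, j) (i', j)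

/-- The Rényi 2-entropy `H₂(ψ) = -log Tr(ρ²)` (natural logarithm), with `ρ` the reduced density
matrix of `ψ`; the trace is real. -/
noncomputable def renyiTwoEntropy {d : ℕ} (ψ : EuclideanSpace ℂ (Fin d × Fin d)) : ℝ :=
  -Real.log (Matrix.trace (reducedDensity ψ * reducedDensity ψ)).re

/-- `U` is the reflection `I - 2|ψ⟩⟨ψ|`. -/
def IsReflectionOracle {ι : Type} [Fintype ι] [DecidableEq ι] (U : Matrix.unitaryGroup ι ℂ)
    (ψ : EuclideanSpace ℂ ι) : Prop :=
  U.1 = 1 - (2 : ℂ) • pureDensity ψ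

theorem renyiTwoEntropy_eq_of_reflection {d : ℕ} {U : Matrix.unitaryGroup (Fin d × Fin d) ℂ}
    {ψ φ : EuclideanSpace ℂ (Fin d × Fin d)} (hψ : IsReflectionOracle U ψ)
    (hφ : IsReflectionOracle U φ) : renyiTwoEntropy ψ = renyiTwoEntropy φ := by
  have h : pureDensity ψ = pureDensity φ := by
    have h1 := hψ.symm.trans hφ
    have h2 := sub_right_injective h1
    exact smul_right_injective _ (two_ne_zero (α := ℂ)) h2
  have h3 : reducedDensity ψ = reducedDensity φ := by
    unfold reducedDensity
    rw [h]
  unfold renyiTwoEntropy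
  rw [h3]

/-- The Entanglement Entropy problem: given the reflection oracle `I - 2|ψ⟩⟨ψ|` of a state
`ψ ∈ ℂ^d ⊗ ℂ^d`, distinguish high entropy `H₂(ψ) ≥ b` (to be accepted) from low entropy
`H₂(ψ) ≤ a` (to be rejected). -/
def entanglementEntropyProblem (d : ℕ) (a b : ℝ) (hab : a < b) :
    UnitaryProperty (Fin d × Fin d) where
  yes := {U | ∃ ψ : EuclideanSpace ℂ (Fin d × Fin d),
    ‖ψ‖ = 1 ∧ IsReflectionOracle U ψ ∧ b ≤ renyiTwoEntropy ψ}
  no := {U | ∃ ψ : EuclideanSpace ℂ (Fin d × Fin d),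
    ‖ψ‖ = 1 ∧ IsReflectionOracle U ψ ∧ renyiTwoEntropy ψ ≤ a}
  disj := by
    rw [Set.disjoint_left]
    rintro U ⟨ψ, -, hψ, hb⟩ ⟨φ, -, hφ, ha⟩
    have := renyiTwoEntropy_eq_of_reflection hψ hφ
    linarith

/-! The proof is a polynomial method in which the witness is removed by a trace. Join a product
state to the maximally entangled state by a path of Schmidt coefficients depending on an angle `x`,
so that the entries of `I - 2|ψ⟩⟨ψ|` are trigonometric polynomials of degree 1 in `x`. After `T`
queries the amplitudes have degree `T`, and the acceptance operator `M` on the `2 ^ m`-dimensional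
witness space, whose quadratic form is the acceptance probability, has entries of degree `2T`.

The tester conditions say that the top eigenvalue of `M` is at least 2/3 on yes instances and at
most 1/3 on no instances. Hence `Tr (M ^ (2m))`, of degree `4mT`, is at least `(4/9) ^ m` on the
former and at most `2 ^ m * (1/9) ^ m = (2/9) ^ m` on the latter; the power `2m` absorbs the
dimension and leaves a ratio `2 ^ m ≥ 2`.

Averaging over `x` and `-x` gives a real polynomial in `cos x`. With `δ = exp (-a/2)`, angles with
`cos² (x/2) ≥ δ`, that is `cos x ≥ -1 + 2δ`, are no instances, and `cos² (x/2) = 1/d` is a yes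
instance. After rescaling, the polynomial is bounded by 1 on `[-1 + 2δ, 1]` and reaches 2 in the
short remaining gap. Chebyshev extremality (`one_le_sq_mul_of_two_le_eval_gap`) forces its degree to
be of order at least `δ ^ (-1/2) = exp (a/4)`. -/

/-- The function `f` is a trigonometric polynomial of degree at most `n`, in the form
`P (cos x) + sin x * R (cos x)` with `P` of degree at most `n` and `R` of degree less than `n`. -/
def IsTrigPoly (n : ℕ) (f : ℝ → ℂ) : Prop :=
  ∃ P R : Polynomial ℂ, P.natDegree ≤ n ∧ (Polynomial.X * R).natDegree ≤ n ∧
    ∀ x : ℝ, f x = P.eval (Complex.cos x) + Complex.sin x * R.eval (Complex.cos x)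

/-! ### Algebra of trigonometric polynomials -/

namespace IsTrigPoly

open Polynomial

theorem const (n : ℕ) (c : ℂ) : IsTrigPoly n fun _ => c :=
  ⟨C c, 0, by simp, by simp, by simp⟩

theorem mono {n k : ℕ} {f : ℝ → ℂ} (hf : IsTrigPoly n f) (h : n ≤ k) : IsTrigPoly k f := by
  obtain ⟨P, R, hP, hR, hf⟩ := hf
  exact ⟨P, R, hP.trans h, hR.trans h, hf⟩

theorem add {n : ℕ} {f g : ℝ → ℂ} (hf : IsTrigPoly n f) (hg : IsTrigPoly n g) :
    IsTrigPoly n fun x => f x + g x := by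
  obtain ⟨P, R, hP, hR, hf⟩ := hf
  obtain ⟨P', R', hP', hR', hg⟩ := hg
  refine ⟨P + P', R + R', natDegree_add_le_of_degree_le hP hP', ?_, fun x => ?_⟩
  · rw [mul_add]
    exact natDegree_add_le_of_degree_le hR hR'
  · simp only [hf, hg, eval_add]
    ring

theorem sum {n : ℕ} {κ : Type*} (s : Finset κ) {f : κ → ℝ → ℂ}
    (hf : ∀ i ∈ s, IsTrigPoly n (f i)) : IsTrigPoly n fun x => ∑ i ∈ s, f i x := by
  classical
  induction s using Finset.induction_on with
  | empty => simpa using const n 0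
  | insert i s hi ih =>
    simp only [Finset.sum_insert hi]
    exact (hf i (Finset.mem_insert_self i s)).add
      (ih fun j hj => hf j (Finset.mem_insert_of_mem hj))

theorem natDegree_le_of_X_mul {n : ℕ} {R : ℂ[X]} (h : (X * R).natDegree ≤ n) :
    R.natDegree ≤ n := by
  by_cases hR : R = 0
  · simp [hR]
  · rw [natDegree_X_mul hR] at h
    omega

/-- The product of the two sine terms is a polynomial in the cosine by `sin² = 1 - cos²`. Bounding
the degree of `X * R` instead of `R` makes the degrees add exactly and forces `R = 0` in degree 0.
-/
theorem mul {n k : ℕ} {f g : ℝ → ℂ} (hf : IsTrigPoly n f) (hg : IsTrigPoly k g) :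
    IsTrigPoly (n + k) fun x => f x * g x := by
  obtain ⟨P, R, hP, hR, hf⟩ := hf
  obtain ⟨P', R', hP', hR', hg⟩ := hg
  refine ⟨P * P' + (R * R' - (X * R) * (X * R')), P * R' + R * P', ?_, ?_, fun x => ?_⟩
  · refine natDegree_add_le_of_degree_le (natDegree_mul_le_of_le hP hP')
      (natDegree_sub_le_of_le (natDegree_mul_le_of_le ?_ ?_) (natDegree_mul_le_of_le hR hR') |>.trans
        (max_self _).le)
    exacts [natDegree_le_of_X_mul hR, natDegree_le_of_X_mul hR']
  · have h : X * (P * R' + R * P') = P * (X * R') + (X * R) * P' := by ring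
    rw [h]
    exact natDegree_add_le_of_degree_le (natDegree_mul_le_of_le hP hR')
      (natDegree_mul_le_of_le hR hP')
  · simp only [hf, hg, eval_add, eval_mul, eval_sub, eval_X]
    linear_combination
      (R.eval (Complex.cos x) * R'.eval (Complex.cos x)) * Complex.sin_sq_add_cos_sq (x : ℂ)

theorem const_mul {n : ℕ} {f : ℝ → ℂ} (c : ℂ) (hf : IsTrigPoly n f) :
    IsTrigPoly n fun x => c * f x := by
  simpa using (const 0 c).mul hf

theorem star {n : ℕ} {f : ℝ → ℂ} (hf : IsTrigPoly n f) : IsTrigPoly n fun x => star (f x) := by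
  obtain ⟨P, R, hP, hR, hf⟩ := hf
  have key : ∀ (Q : ℂ[X]) (x : ℝ), (Q.map (starRingEnd ℂ)).eval (Complex.cos x) =
      starRingEnd ℂ (Q.eval (Complex.cos x)) := fun Q x => by
    rw [← Complex.ofReal_cos, ← Polynomial.eval_map_apply, Complex.conj_ofReal]
  refine ⟨P.map (starRingEnd ℂ), R.map (starRingEnd ℂ), by rwa [natDegree_map], ?_, fun x => ?_⟩
  · rw [← map_X (starRingEnd ℂ), ← Polynomial.map_mul, natDegree_map]
    exact hR
  · simp only [hf, key, star_add, star_mul']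
    simp [← Complex.sin_conj]

theorem cos : IsTrigPoly 1 fun x => Complex.cos x :=
  ⟨X, 0, by simp, by simp, by simp⟩

theorem sin : IsTrigPoly 1 fun x => Complex.sin x :=
  ⟨0, 1, by simp, by simp, by simp⟩

theorem pow_apply {n : ℕ} {κ : Type*} [Fintype κ] [DecidableEq κ] {M : ℝ → Matrix κ κ ℂ}
    (hM : ∀ i j, IsTrigPoly n fun x => M x i j) (k : ℕ) (i j : κ) :
    IsTrigPoly (n * k) fun x => (M x ^ k) i j := by
  induction k generalizing i j with
  | zero => simpa using const 0 _
  | succ k ih =>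
    simp only [pow_succ, Matrix.mul_apply]
    exact sum _ fun l _ => (ih i l).mul (hM l j)

/-- The even part of a trigonometric polynomial is a polynomial in `cos x`. -/
theorem exists_even_part {n : ℕ} {f : ℝ → ℂ} (hf : IsTrigPoly n f) :
    ∃ p : ℝ[X], p.natDegree ≤ n ∧ ∀ x : ℝ, p.eval (Real.cos x) = ((f x).re + (f (-x)).re) / 2 := by
  obtain ⟨P, R, hP, -, hf⟩ := hf
  -- The sine part is odd and cancels; since `cos x` is real, taking real parts of the values
  -- amounts to taking real parts of the coefficients.
  refine ⟨∑ i ∈ Finset.range (n + 1), C (P.coeff i).re * X ^ i, ?_, fun x => ?_⟩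
  · refine natDegree_sum_le_of_forall_le _ _ fun i hi => ?_
    exact (natDegree_C_mul_X_pow_le _ _).trans (by simpa [Nat.lt_succ_iff] using hi)
  · have h : f x + f (-x) = (2 : ℝ) * P.eval (Complex.cos x) := by
      rw [hf, hf, Complex.ofReal_neg, Complex.cos_neg, Complex.sin_neg, Complex.ofReal_ofNat]
      ring
    rw [← Complex.add_re, h, eval_eq_sum_range' (Nat.lt_succ_of_le hP), ← Complex.ofReal_cos]
    have hre : ∀ i, (P.coeff i * (Real.cos x : ℂ) ^ i).re = (P.coeff i).re * Real.cos x ^ i :=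
      fun i => by rw [← Complex.ofReal_pow, Complex.re_mul_ofReal]
    rw [Complex.re_ofReal_mul, Complex.re_sum]
    simp [eval_finsetSum, hre, -Complex.ofReal_cos]

end IsTrigPoly

/-! ### Traces of powers of positive semidefinite matrices -/

namespace Matrix

open scoped ComplexOrder

variable {κ : Type*} [Fintype κ] [DecidableEq κ] {M : Matrix κ κ ℂ}

theorem IsHermitian.trace_pow_eq_sum_eigenvalues (hM : M.IsHermitian) (k : ℕ) :
    (M ^ k).trace = ∑ i, (hM.eigenvalues i : ℂ) ^ k := by
  conv_lhs => rw [hM.spectral_theorem, ← map_pow, diagonal_pow, Unitary.conjStarAlgAut_apply,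
    trace_mul_cycle, Unitary.coe_star_mul_self, one_mul, trace_diagonal]
  simp

/-- If the quadratic form of a positive semidefinite matrix is at most `c` on unit vectors, the
trace of its `k`-th power is at most `c ^ k` times the dimension. -/
theorem PosSemidef.trace_pow_le (hM : M.PosSemidef) {c : ℝ} (k : ℕ)
    (h : ∀ w : EuclideanSpace ℂ κ, ‖w‖ = 1 → (star ⇑w ⬝ᵥ M *ᵥ ⇑w).re ≤ c) :
    (M ^ k).trace.re ≤ Fintype.card κ * c ^ k := by
  rw [hM.1.trace_pow_eq_sum_eigenvalues, Complex.re_sum, ← nsmul_eq_mul]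
  refine Finset.sum_le_card_nsmul _ _ _ fun i _ => ?_
  rw [← Complex.ofReal_pow, Complex.ofReal_re]
  refine pow_le_pow_left₀ (hM.eigenvalues_nonneg i) ?_ k
  rw [hM.1.eigenvalues_eq]
  exact h _ (hM.1.eigenvectorBasis.orthonormal.1 i)

theorem PosSemidef.trace_pow_nonneg (hM : M.PosSemidef) (k : ℕ) : 0 ≤ (M ^ k).trace.re := by
  rw [hM.1.trace_pow_eq_sum_eigenvalues, Complex.re_sum]
  refine Finset.sum_nonneg fun i _ => ?_
  rw [← Complex.ofReal_pow, Complex.ofReal_re]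
  exact pow_nonneg (hM.eigenvalues_nonneg i) k

theorem IsHermitian.re_dotProduct_mulVec_eq (hM : M.IsHermitian) (w : EuclideanSpace ℂ κ) :
    (star ⇑w ⬝ᵥ M *ᵥ ⇑w).re =
      ∑ i, hM.eigenvalues i * ‖inner ℂ (hM.eigenvectorBasis i) w‖ ^ 2 := by
  have h : M *ᵥ ⇑w = ⇑(∑ i, (inner ℂ (hM.eigenvectorBasis i) w * (hM.eigenvalues i : ℂ)) •
      hM.eigenvectorBasis i) := by
    conv_lhs => rw [← hM.eigenvectorBasis.sum_repr' w]
    simp only [WithLp.ofLp_sum, WithLp.ofLp_smul, mulVec_sum, mulVec_smul,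
      hM.mulVec_eigenvectorBasis, mul_smul]
    rfl
  rw [h, dotProduct_comm, ← EuclideanSpace.inner_eq_star_dotProduct, inner_sum, Complex.re_sum]
  refine Finset.sum_congr rfl fun i _ => ?_
  rw [inner_smul_right, mul_right_comm, ← inner_conj_symm w, Complex.mul_conj',
    ← Complex.ofReal_pow, ← Complex.ofReal_mul, Complex.ofReal_re, mul_comm]

/-- The `k`-th power of any value of the quadratic form of a positive semidefinite matrix at a unit
vector is at most the trace of the `k`-th power. -/
theorem PosSemidef.le_trace_pow (hM : M.PosSemidef) {c : ℝ} (hc : 0 ≤ c) (k : ℕ)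
    (w : EuclideanSpace ℂ κ) (hw : ‖w‖ = 1) (h : c ≤ (star ⇑w ⬝ᵥ M *ᵥ ⇑w).re) :
    c ^ k ≤ (M ^ k).trace.re := by
  obtain ⟨i, hi⟩ : ∃ i, c ≤ hM.1.eigenvalues i := by
    -- The quadratic form at `w` is an average of the eigenvalues with weights summing to 1, so they
    -- cannot all lie below `c`.
    by_contra! hlt
    have hsum : ∑ i, ‖inner ℂ (hM.1.eigenvectorBasis i) w‖ ^ 2 = 1 := by
      rw [hM.1.eigenvectorBasis.sum_sq_norm_inner_right, hw, one_pow]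
    rw [hM.1.re_dotProduct_mulVec_eq] at h
    obtain ⟨j, -, hj⟩ : ∃ j ∈ Finset.univ, 0 < ‖inner ℂ (hM.1.eigenvectorBasis j) w‖ ^ 2 := by
      refine Finset.exists_lt_of_sum_lt ?_
      simp [hsum]
    have : ∑ i, hM.1.eigenvalues i * ‖inner ℂ (hM.1.eigenvectorBasis i) w‖ ^ 2 <
        ∑ i, c * ‖inner ℂ (hM.1.eigenvectorBasis i) w‖ ^ 2 :=
      Finset.sum_lt_sum (fun i _ => mul_le_mul_of_nonneg_right (hlt i).le (sq_nonneg _))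
        ⟨j, Finset.mem_univ j, mul_lt_mul_of_pos_right (hlt j) hj⟩
    rw [← Finset.mul_sum, hsum] at this
    linarith
  rw [hM.1.trace_pow_eq_sum_eigenvalues, Complex.re_sum]
  have hre : ∀ j, ((hM.1.eigenvalues j : ℂ) ^ k).re = hM.1.eigenvalues j ^ k := fun j => by
    rw [← Complex.ofReal_pow, Complex.ofReal_re]
  simp only [hre]
  exact (pow_le_pow_left₀ hc hi k).trans (Finset.single_le_sum
    (f := fun j => hM.1.eigenvalues j ^ k)
    (fun j _ => pow_nonneg (hM.eigenvalues_nonneg j) k) (Finset.mem_univ i))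

end Matrix

/-! ### Chebyshev growth outside an interval -/

namespace Polynomial

/-- Used to bound `arcosh (1 + η)` by `√(2η)`. -/
theorem one_add_sq_div_two_le_cosh {u : ℝ} (hu : 0 ≤ u) : 1 + u ^ 2 / 2 ≤ Real.cosh u := by
  have h1 : Real.cosh u = 1 + 2 * Real.sinh (u / 2) ^ 2 := by
    have h := Real.cosh_two_mul (u / 2)
    have h' := Real.cosh_sq (u / 2)
    rw [mul_div_cancel₀ u two_ne_zero] at h
    rw [h, h']
    ring
  have h2 : u / 2 ≤ Real.sinh (u / 2) := Real.self_le_sinh_iff.2 (by linarith)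
  have h3 : (u / 2) ^ 2 ≤ Real.sinh (u / 2) ^ 2 := pow_le_pow_left₀ (by linarith) h2 2
  rw [h1]
  linarith

/-- A polynomial of degree at most `n` which is bounded by `1` on `[-1, 1]` and reaches `2` at
`1 + η` has `n ^ 2 * η` bounded below. -/
theorem one_le_sq_mul_of_two_le_eval {n : ℕ} {p : Polynomial ℝ} (hp : p.natDegree ≤ n)
    (hb : ∀ y ∈ Set.Icc (-1 : ℝ) 1, |p.eval y| ≤ 1) {η : ℝ} (hη : 0 ≤ η)
    (h2 : 2 ≤ p.eval (1 + η)) : 1 ≤ 2 * (n : ℝ) ^ 2 * η := by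
  have h1 : (1 : ℝ) ≤ 1 + η := by linarith
  -- The zeroth derivative: `p (1 + η) ≤ T_n (1 + η) = cosh (n * u)` with `cosh u = 1 + η`.
  have hT := Chebyshev.eval_iterate_derivative_le_of_forall_abs_le_one (k := 0) h1
    (natDegree_le_iff_degree_le.1 hp) hb
  simp only [Function.iterate_zero, id_eq] at hT
  set u := Real.arcosh (1 + η) with hu
  have hu0 : 0 ≤ u := Real.arcosh_nonneg h1
  have hcu : Real.cosh u = 1 + η := Real.cosh_arcosh h1
  rw [← hcu, Chebyshev.T_real_cosh] at hT
  have hu2 : u ^ 2 ≤ 2 * η := by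
    have := one_add_sq_div_two_le_cosh hu0
    linarith
  have hle : (2 : ℝ) ≤ Real.exp ((n * u) ^ 2 / 2) := by
    have := Real.cosh_le_exp_half_sq ((n : ℝ) * u)
    rw [hcu] at hT
    push_cast at hT
    linarith
  have hlog : Real.log 2 ≤ (n * u) ^ 2 / 2 := (Real.log_le_iff_le_exp two_pos).2 hle
  -- Now `log 2 ≤ n² u² / 2 ≤ n² η`, and `2 log 2 > 1` finishes.
  have := Real.log_two_gt_d9
  have hmul : (n : ℝ) ^ 2 * u ^ 2 ≤ n ^ 2 * (2 * η) := by gcongr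
  nlinarith

/-- A polynomial of degree at most `n` which is bounded by `1` on `[-1 + 2 * δ, 1]` and reaches `2`
in `[-1, -1 + 2 * δ]` satisfies `n ≥ 1 / √(8 * δ)`. -/
theorem one_le_sq_mul_of_two_le_eval_gap {n : ℕ} {p : Polynomial ℝ} (hp : p.natDegree ≤ n)
    {δ : ℝ} (hδ0 : 0 < δ) (hδ : δ ≤ 1 / 2)
    (hb : ∀ y ∈ Set.Icc (-1 + 2 * δ) 1, |p.eval y| ≤ 1) {y : ℝ}
    (hy : y ∈ Set.Icc (-1) (-1 + 2 * δ)) (h2 : 2 ≤ p.eval y) : 1 ≤ 8 * (n : ℝ) ^ 2 * δ := by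
  have hpos : 0 < 1 - δ := by linarith
  -- The orientation-reversing affine map takes `[-1, 1]` onto `[-1 + 2δ, 1]`, so the gap lies
  -- beyond 1; as `δ ≤ 1/2`, its points are at distance at most `2δ / (1 - δ) ≤ 4δ`.
  let q : Polynomial ℝ := p.comp (C (-(1 - δ)) * X + C δ)
  have hq : ∀ z, q.eval z = p.eval (-(1 - δ) * z + δ) := fun z => by simp [q]
  have hqd : q.natDegree ≤ n := by
    refine natDegree_comp_le.trans ?_
    have : (C (-(1 - δ)) * X + C δ).natDegree ≤ 1 := natDegree_linear_le
    calc p.natDegree * _ ≤ p.natDegree * 1 := Nat.mul_le_mul_left _ this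
      _ ≤ n := by rwa [mul_one]
  have hη : 0 ≤ (-1 + 2 * δ - y) / (1 - δ) := div_nonneg (by linarith [hy.2]) hpos.le
  have hval : -(1 - δ) * (1 + (-1 + 2 * δ - y) / (1 - δ)) + δ = y := by
    field_simp
    ring
  have key := one_le_sq_mul_of_two_le_eval hqd (fun z hz => by
    rw [hq]
    refine hb _ ⟨?_, ?_⟩ <;> nlinarith [hz.1, hz.2]) hη (by rw [hq, hval]; exact h2)
  have hle : (-1 + 2 * δ - y) / (1 - δ) ≤ 4 * δ := by
    rw [div_le_iff₀ hpos]
    nlinarith [hy.1]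
  calc 1 ≤ 2 * (n : ℝ) ^ 2 * ((-1 + 2 * δ - y) / (1 - δ)) := key
    _ ≤ 2 * (n : ℝ) ^ 2 * (4 * δ) := by gcongr
    _ = 8 * (n : ℝ) ^ 2 * δ := by ring

end Polynomial

/-! ### The acceptance operator of a query algorithm -/

theorem controlledApply_sum {ι κ K : Type} [Fintype ι] {M : Matrix ι ι ℂ} (t : Finset κ) (c : κ → ℂ)
    (v : κ → Bool × ι × K → ℂ) (s : Bool × ι × K) :
    controlledApply M (fun s => ∑ j ∈ t, c j * v j s) s =
      ∑ j ∈ t, c j * controlledApply M (v j) s := by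
  obtain ⟨_ | _, i, k⟩ := s
  · rfl
  · simp only [controlledApply, Finset.mul_sum]
    rw [Finset.sum_comm]
    exact Finset.sum_congr rfl fun j _ => Finset.sum_congr rfl fun l _ => by ring

namespace QueryAlgorithm

open scoped ComplexOrder

variable {ι : Type} [Fintype ι] [DecidableEq ι] {m : ℕ}

/-- The acceptance amplitudes: the column of a witness basis state consists of the accepted
components of the final state. -/
noncomputable def amplitude (A : QueryAlgorithm ι m) (U : Matrix.unitaryGroup ι ℂ) :
    Matrix A.accept (Fin m → Bool) ℂ :=
  Matrix.of fun s j => A.stateAfter U (EuclideanSpace.single j 1) A.numQueries s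

theorem stateAfter_eq_sum (A : QueryAlgorithm ι m) (U : Matrix.unitaryGroup ι ℂ)
    (w : EuclideanSpace ℂ (Fin m → Bool)) (t : ℕ) :
    A.stateAfter U w t =
      fun s => ∑ j, w j * A.stateAfter U (EuclideanSpace.single j 1) t s := by
  have hmul : ∀ (G : Matrix (RegisterIndex ι A.ancDim m) (RegisterIndex ι A.ancDim m) ℂ)
      (v : (Fin m → Bool) → RegisterIndex ι A.ancDim m → ℂ),
      G.mulVec (fun s => ∑ j, w j * v j s) = fun s => ∑ j, w j * G.mulVec (v j) s := by
    intro G v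
    funext s
    simp only [Matrix.mulVec, dotProduct, Finset.mul_sum]
    rw [Finset.sum_comm]
    exact Finset.sum_congr rfl fun j _ => Finset.sum_congr rfl fun l _ => by ring
  induction t with
  | zero =>
    have h : A.initialState w =
        fun s => ∑ j, w j * A.initialState (EuclideanSpace.single j 1) s := by
      funext s
      by_cases hs : (s.1, s.2.1, s.2.2.1) = A.start <;> simp [initialState, hs]
    simp only [stateAfter]
    rw [h, hmul]
  | succ t ih =>
    simp only [stateAfter]
    rw [← hmul, ih]
    congr 1
    funext s
    exact controlledApply_sum _ _ _ s

/-- By linearity in the witness, the accepted part of the final state is `amplitude` applied to `w`,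
so the tester conditions become eigenvalue bounds on a Gram matrix. -/
theorem acceptProb_eq (A : QueryAlgorithm ι m) (U : Matrix.unitaryGroup ι ℂ)
    (w : EuclideanSpace ℂ (Fin m → Bool)) :
    A.acceptProb U w =
      (star ⇑w ⬝ᵥ ((A.amplitude U).conjTranspose * A.amplitude U).mulVec ⇑w).re := by
  rw [← Matrix.mulVec_mulVec, Matrix.dotProduct_mulVec, Matrix.vecMul_conjTranspose, star_star,
    dotProduct, Complex.re_sum, acceptProb, ← Finset.sum_coe_sort]
  refine Finset.sum_congr rfl fun s _ => ?_
  rw [stateAfter_eq_sum]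
  have h : (A.amplitude U).mulVec ⇑w s =
      ∑ j, w j * A.stateAfter U (EuclideanSpace.single j 1) A.numQueries s := by
    simp only [Matrix.mulVec, dotProduct, amplitude, Matrix.of_apply, mul_comm]
  rw [Pi.star_apply, h, Complex.star_def, Complex.conj_mul', ← Complex.ofReal_pow,
    Complex.ofReal_re]

/-- Fixed gates preserve the degree and each query raises it by at most one, also for `U*`, since
conjugation preserves the degree. -/
theorem isTrigPoly_stateAfter (A : QueryAlgorithm ι m) {U : ℝ → Matrix.unitaryGroup ι ℂ}
    (hU : ∀ i j, IsTrigPoly 1 fun x => (U x).1 i j) (w : EuclideanSpace ℂ (Fin m → Bool)) (t : ℕ)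
    (s : RegisterIndex ι A.ancDim m) : IsTrigPoly t fun x => A.stateAfter (U x) w t s := by
  induction t generalizing s with
  | zero => exact IsTrigPoly.const 0 _
  | succ t ih =>
    simp only [stateAfter, Matrix.mulVec, dotProduct]
    refine IsTrigPoly.sum _ fun s _ => IsTrigPoly.const_mul _ ?_
    obtain ⟨_ | _, i, k⟩ := s
    · exact (ih _).mono t.le_succ
    · simp only [controlledApply, add_comm t 1]
      refine IsTrigPoly.sum _ fun j _ => IsTrigPoly.mul ?_ (ih _)
      cases A.useInverse t
      · exact hU i j
      · exact (hU j i).star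

/-- The trace of the `k`-th power of the acceptance operator on the witness register. -/
noncomputable def acceptTrace (A : QueryAlgorithm ι m) (k : ℕ) (U : Matrix.unitaryGroup ι ℂ) : ℂ :=
  (((A.amplitude U).conjTranspose * A.amplitude U) ^ k).trace

theorem isTrigPoly_acceptTrace (A : QueryAlgorithm ι m) (k : ℕ)
    {U : ℝ → Matrix.unitaryGroup ι ℂ} (hU : ∀ i j, IsTrigPoly 1 fun x => (U x).1 i j) :
    IsTrigPoly (2 * A.numQueries * k) fun x => A.acceptTrace k (U x) := by
  simp only [acceptTrace, Matrix.trace, Matrix.diag]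
  refine IsTrigPoly.sum _ fun i _ => IsTrigPoly.pow_apply (fun i j => ?_) k i i
  simp only [Matrix.mul_apply, Matrix.conjTranspose_apply, two_mul]
  exact IsTrigPoly.sum _ fun s _ => ((A.isTrigPoly_stateAfter hU _ _ _).star).mul
    (A.isTrigPoly_stateAfter hU _ _ _)

theorem acceptTrace_nonneg (A : QueryAlgorithm ι m) (k : ℕ) (U : Matrix.unitaryGroup ι ℂ) :
    0 ≤ (A.acceptTrace k U).re :=
  (Matrix.posSemidef_conjTranspose_mul_self _).trace_pow_nonneg k

theorem IsQMATester.le_acceptTrace {A : QueryAlgorithm ι m} {P : UnitaryProperty ι}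
    (hA : A.IsQMATester P) (k : ℕ) {U : Matrix.unitaryGroup ι ℂ} (hU : U ∈ P.yes) :
    (2 / 3 : ℝ) ^ k ≤ (A.acceptTrace k U).re := by
  obtain ⟨w, hw, h⟩ := hA.1 U hU
  rw [acceptProb_eq] at h
  exact (Matrix.posSemidef_conjTranspose_mul_self _).le_trace_pow (by norm_num) k w hw h

theorem IsQMATester.acceptTrace_le {A : QueryAlgorithm ι m} {P : UnitaryProperty ι}
    (hA : A.IsQMATester P) (k : ℕ) {U : Matrix.unitaryGroup ι ℂ} (hU : U ∈ P.no) :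
    (A.acceptTrace k U).re ≤ 2 ^ m * (1 / 3 : ℝ) ^ k := by
  have h := (Matrix.posSemidef_conjTranspose_mul_self (A.amplitude U)).trace_pow_le (c := 1 / 3) k
    fun w hw => by
      rw [← acceptProb_eq]
      exact hA.2 U hU w hw
  simpa [acceptTrace] using h

end QueryAlgorithm

/-! ### Reflection oracles and the interpolating family of states -/

/-- The reflection `1 - 2|ψ⟩⟨ψ|` through the complement of a unit vector `ψ`. -/
noncomputable def reflectionOracle {ι : Type} [Fintype ι] [DecidableEq ι]
    (ψ : EuclideanSpace ℂ ι) (hψ : ‖ψ‖ = 1) : Matrix.unitaryGroup ι ℂ :=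
  ⟨1 - (2 : ℂ) • pureDensity ψ, by
    have hself : star (pureDensity ψ) = pureDensity ψ := by
      ext i j
      simp [pureDensity, Matrix.star_apply, mul_comm]
    have hidem : pureDensity ψ * pureDensity ψ = pureDensity ψ := by
      have hsum : ∑ k, star (ψ k) * ψ k = 1 := by
        have h := EuclideanSpace.norm_sq_eq ψ
        rw [hψ] at h
        simp only [Complex.star_def, Complex.conj_mul']
        exact_mod_cast h.symm.trans (one_pow 2)
      ext i j
      simp only [pureDensity, Matrix.mul_apply, Matrix.of_apply]
      calc ∑ k, ψ i * star (ψ k) * (ψ k * star (ψ j))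
          = ψ i * star (ψ j) * ∑ k, star (ψ k) * ψ k := by
            rw [Finset.mul_sum]
            exact Finset.sum_congr rfl fun k _ => by ring
        _ = ψ i * star (ψ j) := by rw [hsum, mul_one]
    rw [Matrix.mem_unitaryGroup_iff, star_sub, star_one, star_smul, hself, Complex.star_def,
      Complex.conj_ofNat, mul_sub, mul_one, sub_mul, one_mul, smul_mul_smul_comm, hidem]
    module⟩

theorem isReflectionOracle_reflectionOracle {ι : Type} [Fintype ι] [DecidableEq ι]
    (ψ : EuclideanSpace ℂ ι) (hψ : ‖ψ‖ = 1) : IsReflectionOracle (reflectionOracle ψ hψ) ψ :=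
  rfl

/-- The bipartite state `∑ p, c p |p⟩|p⟩` with Schmidt coefficients `c`. -/
noncomputable def schmidtState {d : ℕ} (c : Fin d → ℝ) : EuclideanSpace ℂ (Fin d × Fin d) :=
  WithLp.toLp 2 fun i => if i.1 = i.2 then (c i.1 : ℂ) else 0

theorem norm_schmidtState {d : ℕ} {c : Fin d → ℝ} (hc : ∑ p, c p ^ 2 = 1) :
    ‖schmidtState c‖ = 1 := by
  have h : ‖schmidtState c‖ ^ 2 = 1 := by
    rw [EuclideanSpace.norm_sq_eq, Fintype.sum_prod_type, ← hc]
    refine Finset.sum_congr rfl fun p _ => ?_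
    rw [Finset.sum_eq_single p] <;> simp +contextual [schmidtState, eq_comm]
  exact (pow_eq_one_iff_of_nonneg (norm_nonneg _) two_ne_zero).1 h

theorem renyiTwoEntropy_schmidtState {d : ℕ} (c : Fin d → ℝ) :
    renyiTwoEntropy (schmidtState c) = -Real.log (∑ p, c p ^ 4) := by
  have h : reducedDensity (schmidtState c) = Matrix.diagonal fun p => ((c p ^ 2 : ℝ) : ℂ) := by
    ext p q
    rw [Matrix.diagonal_apply]
    simp only [reducedDensity, pureDensity, schmidtState, Matrix.of_apply]
    rw [Finset.sum_eq_single p]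
    · by_cases hpq : p = q
      · simp [hpq, sq]
      · simp [hpq, Ne.symm hpq]
    · intro r _ hr
      simp [Ne.symm hr]
    · simp
  rw [renyiTwoEntropy, h, Matrix.diagonal_mul_diagonal, Matrix.trace_diagonal, Complex.re_sum]
  congr 2
  refine Finset.sum_congr rfl fun p _ => ?_
  rw [← Complex.ofReal_mul, Complex.ofReal_re]
  ring

section InterpolatingFamily

variable {d : ℕ} [NeZero d]

/-- Schmidt coefficients interpolating between a product state at angle `0` and a state that is
maximally entangled on the complement of the first basis vector at angle `π`. -/
noncomputable def schmidtFamily (d : ℕ) [NeZero d] (x : ℝ) (p : Fin d) : ℝ :=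
  if p = 0 then Real.cos (x / 2) else Real.sin (x / 2) / √((d : ℝ) - 1)

theorem sum_schmidtFamily_pow (x : ℝ) (k : ℕ) :
    ∑ p, schmidtFamily d x p ^ k =
      Real.cos (x / 2) ^ k + ((d : ℝ) - 1) * (Real.sin (x / 2) / √((d : ℝ) - 1)) ^ k := by
  rw [← Finset.add_sum_erase _ _ (Finset.mem_univ (0 : Fin d))]
  have h : ∀ p ∈ Finset.univ.erase (0 : Fin d), schmidtFamily d x p ^ k =
      (Real.sin (x / 2) / √((d : ℝ) - 1)) ^ k := fun p hp => by
    rw [schmidtFamily, if_neg (Finset.ne_of_mem_erase hp)]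
  rw [Finset.sum_congr rfl h, Finset.sum_const, Finset.card_erase_of_mem (Finset.mem_univ _),
    Finset.card_univ, Fintype.card_fin, nsmul_eq_mul, Nat.cast_pred (Nat.pos_of_neZero d),
    schmidtFamily, if_pos rfl]

theorem sum_schmidtFamily_sq (hd : 1 < d) (x : ℝ) : ∑ p, schmidtFamily d x p ^ 2 = 1 := by
  have h : (0 : ℝ) < (d : ℝ) - 1 := sub_pos.2 (by exact_mod_cast hd)
  rw [sum_schmidtFamily_pow, div_pow, Real.sq_sqrt h.le, mul_div_cancel₀ _ h.ne',
    Real.cos_sq_add_sin_sq]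

/-- The reflection oracles of the interpolating family of states. -/
noncomputable def oracleFamily (hd : 1 < d) (x : ℝ) :
    Matrix.unitaryGroup (Fin d × Fin d) ℂ :=
  reflectionOracle (schmidtState (schmidtFamily d x)) (norm_schmidtState (sum_schmidtFamily_sq hd x))

/-- The coefficients involve `x / 2`, but `|ψ⟩⟨ψ|` contains only products of two of them, which
double-angle identities turn into functions of `cos x` and `sin x`. -/
theorem isTrigPoly_schmidtFamily_mul (p q : Fin d) :
    IsTrigPoly 1 fun x => ((schmidtFamily d x p * schmidtFamily d x q : ℝ) : ℂ) := by
  have hcc : IsTrigPoly 1 fun x => ((Real.cos (x / 2) * Real.cos (x / 2) : ℝ) : ℂ) := by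
    convert! ((IsTrigPoly.const 1 1).add IsTrigPoly.cos).const_mul (1 / 2) using 2 with x
    rw [← sq, Real.cos_sq, mul_div_cancel₀ x two_ne_zero]
    push_cast
    ring
  have hss : IsTrigPoly 1 fun x => ((Real.sin (x / 2) * Real.sin (x / 2) : ℝ) : ℂ) := by
    convert! ((IsTrigPoly.const 1 1).add (IsTrigPoly.cos.const_mul (-1))).const_mul (1 / 2)
      using 2 with x
    rw [← sq, Real.sin_sq, Real.cos_sq, mul_div_cancel₀ x two_ne_zero]
    push_cast
    ring
  have hcs : IsTrigPoly 1 fun x => ((Real.cos (x / 2) * Real.sin (x / 2) : ℝ) : ℂ) := by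
    convert! IsTrigPoly.sin.const_mul (1 / 2) using 2 with x
    have h := Real.sin_two_mul (x / 2)
    rw [mul_div_cancel₀ x two_ne_zero] at h
    rw [← Complex.ofReal_sin, h]
    push_cast
    ring
  set r := √((d : ℝ) - 1)
  by_cases hp : p = 0 <;> by_cases hq : q = 0
  · simpa only [schmidtFamily, hp, hq, if_true] using hcc
  · convert! hcs.const_mul ((r⁻¹ : ℝ) : ℂ) using 2 with x
    simp only [schmidtFamily, hp, hq, if_true, if_false, ← Complex.ofReal_mul]
    congr 1
    ring
  · convert! hcs.const_mul ((r⁻¹ : ℝ) : ℂ) using 2 with x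
    simp only [schmidtFamily, hp, hq, if_true, if_false, ← Complex.ofReal_mul]
    congr 1
    ring
  · convert! hss.const_mul ((r⁻¹ * r⁻¹ : ℝ) : ℂ) using 2 with x
    simp only [schmidtFamily, hp, hq, if_false, ← Complex.ofReal_mul]
    congr 1
    ring

theorem isTrigPoly_oracleFamily (hd : 1 < d) (i j : Fin d × Fin d) :
    IsTrigPoly 1 fun x => (oracleFamily hd x).1 i j := by
  have h : IsTrigPoly 1 fun x => pureDensity (schmidtState (schmidtFamily d x)) i j := by
    by_cases hi : i.1 = i.2
    · by_cases hj : j.1 = j.2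
      · convert! isTrigPoly_schmidtFamily_mul i.1 j.1 using 2 with x
        rw [Complex.ofReal_mul]
        simp only [pureDensity, schmidtState, Matrix.of_apply, if_pos hi, if_pos hj,
          Complex.star_def, Complex.conj_ofReal]
      · simpa [pureDensity, schmidtState, hj] using IsTrigPoly.const 1 0
    · simpa [pureDensity, schmidtState, hi] using IsTrigPoly.const 1 0
  convert! (IsTrigPoly.const 1 ((1 : Matrix (Fin d × Fin d) (Fin d × Fin d) ℂ) i j)).add
    (h.const_mul (-2)) using 2 with x
  simp [oracleFamily, reflectionOracle, sub_eq_add_neg]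

/-- The first Schmidt coefficient alone makes the purity at least `cos⁴ (x/2) ≥ exp (-a)`, whence
the exponent `-a / 2` for the squared cosine. -/
theorem oracleFamily_mem_no (hd : 1 < d) {a b : ℝ} (hab : a < b) {x : ℝ}
    (hx : Real.exp (-a / 2) ≤ Real.cos (x / 2) ^ 2) :
    oracleFamily hd x ∈ (entanglementEntropyProblem d a b hab).no := by
  refine ⟨_, norm_schmidtState (sum_schmidtFamily_sq hd x),
    isReflectionOracle_reflectionOracle _ _, ?_⟩
  have h : (0 : ℝ) < (d : ℝ) - 1 := sub_pos.2 (by exact_mod_cast hd)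
  rw [renyiTwoEntropy_schmidtState, sum_schmidtFamily_pow, neg_le]
  have h1 : Real.exp (-a) ≤ Real.cos (x / 2) ^ 4 :=
    calc Real.exp (-a) = Real.exp (-a / 2) ^ 2 := by
          rw [← Real.exp_nat_mul]
          congr 1
          push_cast
          ring
      _ ≤ (Real.cos (x / 2) ^ 2) ^ 2 := pow_le_pow_left₀ (Real.exp_pos _).le hx 2
      _ = Real.cos (x / 2) ^ 4 := by ring
  have h2 : 0 ≤ ((d : ℝ) - 1) * (Real.sin (x / 2) / √((d : ℝ) - 1)) ^ 4 := by positivity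
  have h3 : Real.exp (-a) ≤ Real.cos (x / 2) ^ 4 +
    ((d : ℝ) - 1) * (Real.sin (x / 2) / √((d : ℝ) - 1)) ^ 4 := by linarith
  exact (Real.le_log_iff_exp_le ((Real.exp_pos _).trans_le h3)).2 h3

/-- At this angle every squared Schmidt coefficient equals `1 / d`: the state is maximally
entangled, with entropy `log d`. -/
theorem oracleFamily_mem_yes (hd : 1 < d) {a b : ℝ} (hab : a < b) (hb : b ≤ Real.log d) {x : ℝ}
    (hx : Real.cos (x / 2) ^ 2 = 1 / d) :
    oracleFamily hd x ∈ (entanglementEntropyProblem d a b hab).yes := by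
  refine ⟨_, norm_schmidtState (sum_schmidtFamily_sq hd x),
    isReflectionOracle_reflectionOracle _ _, ?_⟩
  have h : (0 : ℝ) < (d : ℝ) - 1 := sub_pos.2 (by exact_mod_cast hd)
  have hd0 : (d : ℝ) ≠ 0 := by positivity
  have hsum : Real.cos (x / 2) ^ 4 + ((d : ℝ) - 1) * (Real.sin (x / 2) / √((d : ℝ) - 1)) ^ 4 =
      (d : ℝ)⁻¹ := by
    have hs : (Real.sin (x / 2) / √((d : ℝ) - 1)) ^ 2 = 1 / d := by
      rw [div_pow, Real.sq_sqrt h.le, Real.sin_sq, hx]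
      field_simp
    have h4 : ∀ y : ℝ, y ^ 4 = (y ^ 2) ^ 2 := fun y => by ring
    rw [h4, h4, hx, hs]
    field_simp
    ring
  rw [renyiTwoEntropy_schmidtState, sum_schmidtFamily_pow, hsum, Real.log_inv, neg_neg]
  exact hb

end InterpolatingFamily

/-! ### The lower bound -/

theorem QueryAlgorithm.IsQMATester.one_le_numQueries_sq_mul_exp {d m : ℕ} {a b : ℝ} (ha : 5 ≤ a)
    {hab : a < b} (hb : b ≤ Real.log d) (hm : 1 ≤ m) {A : QueryAlgorithm (Fin d × Fin d) m}
    (hA : A.IsQMATester (entanglementEntropyProblem d a b hab)) :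
    1 ≤ 8 * (4 * (m : ℝ) * A.numQueries) ^ 2 * Real.exp (-a / 2) := by
  have hd0 : d ≠ 0 := by
    rintro rfl
    simp only [Nat.cast_zero, Real.log_zero] at hb
    linarith
  have : NeZero d := ⟨hd0⟩
  have hdpos : (0 : ℝ) < d := by positivity
  have hexp : Real.exp a ≤ d := (Real.le_log_iff_exp_le hdpos).1 (hab.le.trans hb)
  have hd : 1 < d := by
    have := Real.add_one_le_exp a
    exact_mod_cast (show (1 : ℝ) < d by linarith)
  set δ := Real.exp (-a / 2) with hδ
  have hδ0 : 0 < δ := Real.exp_pos _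
  have hδ2 : δ ≤ 1 / 2 := by
    have h1 := Real.add_one_le_exp (a / 2)
    rw [hδ, neg_div, Real.exp_neg, one_div]
    exact inv_anti₀ two_pos (by linarith)
  have hdδ : 1 / (d : ℝ) ≤ δ := by
    rw [hδ, neg_div, Real.exp_neg, ← one_div]
    refine one_div_le_one_div_of_le (Real.exp_pos _) (le_trans ?_ hexp)
    exact Real.exp_le_exp.2 (by linarith)
  have hcos : ∀ x : ℝ, Real.cos (x / 2) ^ 2 = (1 + Real.cos x) / 2 := fun x => by
    rw [Real.cos_sq, mul_div_cancel₀ x two_ne_zero]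
    ring
  obtain ⟨p, hp, hpe⟩ := (A.isTrigPoly_acceptTrace (2 * m)
    (isTrigPoly_oracleFamily hd)).exists_even_part
  -- The factor `(9/2) ^ m` normalizes the no-instance bound `(2/9) ^ m` to 1 and takes the
  -- yes-instance bound `(4/9) ^ m` to `2 ^ m`.
  have hq : ∀ y, (Polynomial.C ((9 / 2 : ℝ) ^ m) * p).eval y = (9 / 2 : ℝ) ^ m * p.eval y :=
    fun y => by simp
  have hno : (2 : ℝ) ^ m * (1 / 3) ^ (2 * m) = (2 / 9) ^ m := by
    rw [pow_mul, ← mul_pow]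
    norm_num
  have hle : ∀ x : ℝ, δ ≤ Real.cos (x / 2) ^ 2 →
      (A.acceptTrace (2 * m) (oracleFamily hd x)).re ≤ (2 / 9 : ℝ) ^ m := fun x hx =>
    (hA.acceptTrace_le _ (oracleFamily_mem_no hd hab hx)).trans_eq hno
  have hge : ∀ x : ℝ, Real.cos (x / 2) ^ 2 = 1 / d →
      (4 / 9 : ℝ) ^ m ≤ (A.acceptTrace (2 * m) (oracleFamily hd x)).re := fun x hx => by
    have h := hA.le_acceptTrace (2 * m) (oracleFamily_mem_yes hd hab hb hx)
    rw [pow_mul] at h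
    convert! h using 2
    norm_num
  -- The point `2 / d - 1` is `cos x` at the angle where `cos² (x/2) = 1/d`; it lies in the gap
  -- because `1/d ≤ δ`.
  have key := Polynomial.one_le_sq_mul_of_two_le_eval_gap
    ((Polynomial.natDegree_C_mul_le ((9 / 2 : ℝ) ^ m) p).trans hp) hδ0 hδ2 (fun y hy => ?_)
    (y := 2 / d - 1) ⟨?_, ?_⟩ ?_
  · convert! key using 3
    push_cast
    ring
  · obtain ⟨x, rfl⟩ : ∃ x, Real.cos x = y :=
      ⟨Real.arccos y, Real.cos_arccos (by linarith [hy.1]) hy.2⟩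
    have hx : δ ≤ Real.cos (x / 2) ^ 2 := by
      rw [hcos]
      linarith [hy.1]
    have hx' : δ ≤ Real.cos (-x / 2) ^ 2 := by rwa [neg_div, Real.cos_neg]
    have h1 := hle x hx
    have h2 := hle (-x) hx'
    have h3 := A.acceptTrace_nonneg (2 * m) (oracleFamily hd x)
    have h4 := A.acceptTrace_nonneg (2 * m) (oracleFamily hd (-x))
    rw [hq, hpe, abs_of_nonneg (by positivity)]
    calc (9 / 2 : ℝ) ^ m * _ ≤ (9 / 2 : ℝ) ^ m * (2 / 9) ^ m := by gcongr; linarith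
      _ = 1 := by rw [← mul_pow]; norm_num
  · have : 0 ≤ 2 / (d : ℝ) := by positivity
    linarith
  · have : 2 / (d : ℝ) = 2 * (1 / d) := by ring
    linarith
  · have hd1 : 1 / (d : ℝ) ≤ 1 := by linarith
    have hd2 : 0 ≤ 1 / (d : ℝ) := by positivity
    have h2d : 2 / (d : ℝ) = 2 * (1 / d) := by ring
    have hx : Real.cos (Real.arccos (2 / d - 1)) = 2 / d - 1 :=
      Real.cos_arccos (by linarith) (by linarith)
    set x := Real.arccos (2 / d - 1)
    have hxy : Real.cos (x / 2) ^ 2 = 1 / d := by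
      rw [hcos, hx]
      ring
    have h1 := hge x hxy
    have h2 := hge (-x) (by rwa [neg_div, Real.cos_neg])
    rw [hq, ← hx, hpe]
    calc (2 : ℝ) = 2 ^ 1 := (pow_one 2).symm
      _ ≤ 2 ^ m := pow_le_pow_right₀ one_le_two hm
      _ = (9 / 2 : ℝ) ^ m * (4 / 9) ^ m := by rw [← mul_pow]; norm_num
      _ ≤ _ := by gcongr; linarith

theorem mainTheorem8 :
    ∃ c : ℝ, 0 < c ∧
      ∀ (d : ℕ) (a b : ℝ) (_ha : 5 ≤ a) (hab : a < b) (_hb : b ≤ Real.log d)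
        (m T : ℕ) (_hm : 1 ≤ m) (A : QueryAlgorithm (Fin d × Fin d) m) (_hT : A.numQueries = T)
        (_hA : A.IsQMATester (entanglementEntropyProblem d a b hab)),
        c * Real.exp (a / 4) ≤ (m : ℝ) * (T : ℝ) := by
  -- The degree bound reads `exp (a/4) ^ 2 ≤ 8 * 4² * (m * T) ^ 2 = 128 * (m * T) ^ 2`, and `128 ≤
  -- 12²`.
  refine ⟨1 / 12, by norm_num, ?_⟩
  rintro d a b ha hab hb m _ hm A rfl hA
  have key := hA.one_le_numQueries_sq_mul_exp ha hb hm
  have hexp : Real.exp (-a / 2) * Real.exp (a / 4) ^ 2 = 1 := by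
    rw [← Real.exp_nat_mul, ← Real.exp_add, Real.exp_eq_one_iff]
    push_cast
    ring
  refine le_of_sq_le_sq ?_ (by positivity)
  have h := mul_le_mul_of_nonneg_right key (sq_nonneg (Real.exp (a / 4)))
  rw [one_mul, mul_assoc, hexp] at h
  nlinarith [h]
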